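/- Let $\mathfrak o$ be a compact discrete valuation ring of characteristic $0$ with maximal ideal $\wp$, uniformizer $\pi$ and finite residue field of characteristic $2$, and let $\mathrm e$ be its ramification index, i.e. $2\mathfrak o=\pi^{\mathrm e}\mathfrak o$. For $n\ge 1$ put $\mathfrak o_n=\mathfrak o/\wp^n$. Let $r\ge 2$, $\ell=\lceil r/2\rceil$, $\ell'=\lfloor r/2\rfloor$, and let $\psi:\mathfrak o_r\to\mathbb C^\times$ be an additive character with $\psi(\pi^{r-1})\ne 1$. For $i\le r$ let $M^i$ and $K^i$ be the kernels of the reduction maps $\mathrm{GL}_2(\mathfrak o_r)\to\mathrm{GL}_2(\mathfrak o_i)$ and $\mathrm{SL}_2(\mathfrak o_r)\to\mathrm{SL}_2(\mathfrak o_i)$. Let $A=\begin{pmatrix}0&a^{-1}\alpha\\ a&\beta\end{pmatrix}\in M_2(\mathfrak o_{\ell'})$ with $a\in\mathfrak o_{\ell'}^\times$ and $\alpha,\beta\in\mathfrak o_{\ell'}$, and let $\tilde A=\begin{pmatrix}0&\tilde a^{-1}\tilde\alpha\\ \tilde a&\tilde\beta\end{pmatrix}\in M_2(\mathfrak o_r)$,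 with $\tilde a\in\mathfrak o_r^\times$ and $\tilde\alpha,\tilde\beta\in\mathfrak o_r$, be any lift of $A$ of this form. Let $\psi_{[A]}:K^\ell\to\mathbb C^\times$ be the character $\psi_{[A]}(I+\pi^\ell B)=\psi(\pi^\ell\,\mathrm{trace}(\tilde A B))$, and let $$D_S^\ell(\tilde A)=\bigl((C_{\mathrm{GL}_2(\mathfrak o_r)}(\tilde A)\cap M^1)\,M^\ell\bigr)\cap \mathrm{SL}_2(\mathfrak o_r),\qquad \mathrm h_{\tilde A}^{\ell'}=\{x\in\mathfrak o_r \mid 2x\in\pi^{\ell'}\mathfrak o_r,\ x(x+\tilde\beta)\in\pi^{\ell'}\mathfrak o_r\}.$$ For $\lambda\in\mathfrak o_r$ put $e_\lambda=\begin{pmatrix}1&\tilde a^{-1}\lambda\\0&1\end{pmatrix}$, and let $$E'_{\tilde A}=\{\lambda\in \mathrm h_{\tilde A}^{\ell'} \mid \psi_{[A]}\text{ extends to a one-dimensional representation of the group } D_S^\ell(\tilde A)\langle e_\lambda\rangle\}.$$ Then: 1. If $r\ge 2(\mathrm e+1)$ and $\beta\in\mathfrak o_{\ell'}^\times$, then $E'_{\tilde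 A}=\pi^{\ell'}\mathfrak o_r$. 2. If $r>4\mathrm e$ and $\beta\in\pi\mathfrak o_{\ell'}$, then $E'_{\tilde A}=\pi^{\ell'}\mathfrak o_r$. -/

import Mathlib

open IsLocalRing

noncomputable section

namespace SL2Trunc

/-- The finite quotient `𝔬_n = 𝔬 / ℘ ^ n`, where `℘` is the maximal ideal of `𝔬`. -/
abbrev Trunc (𝔬 : Type*) [CommRing 𝔬] [IsLocalRing 𝔬] (n : ℕ) : Type _ :=
  𝔬 ⧸ (maximalIdeal 𝔬 ^ n)

/-- The image in `𝔬_n` of an element of `𝔬`. -/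
abbrev toTrunc {𝔬 : Type*} [CommRing 𝔬] [IsLocalRing 𝔬] (n : ℕ) : 𝔬 →+* Trunc 𝔬 n :=
  Ideal.Quotient.mk (maximalIdeal 𝔬 ^ n)

/-- The natural surjection `𝔬_r → 𝔬_i` for `i ≤ r`. -/
abbrev red {𝔬 : Type*} [CommRing 𝔬] [IsLocalRing 𝔬] {i r : ℕ} (h : i ≤ r) :
    Trunc 𝔬 r →+* Trunc 𝔬 i :=
  Ideal.Quotient.factor (Ideal.pow_le_pow_right h)

/-- `ℓ = ⌈r / 2⌉`. -/
def ell (r : ℕ) : ℕ := (r + 1) / 2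

/-- `ℓ' = ⌊r / 2⌋`. -/
def ell' (r : ℕ) : ℕ := r / 2

theorem ell_le (r : ℕ) : ell r ≤ r := by unfold ell; omega

theorem ell'_le (r : ℕ) : ell' r ≤ r := by unfold ell'; omega

theorem le_two_mul_ell (r : ℕ) : r ≤ ell r + ell r := by unfold ell; omega

/-- The matrix with rows `(0, a⁻¹ α)` and `(a, β)`. -/
def cyc {R : Type*} [CommRing R] (a : Rˣ) (α β : R) : Matrix (Fin 2) (Fin 2) R :=
  !![0, ((a⁻¹ : Rˣ) : R) * α; (a : R), β]

/-- The centralizer in `GL₂(R)` of a (not necessarily invertible) matrix `X`. -/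
def centralizerGL {R : Type*} [CommRing R] (X : Matrix (Fin 2) (Fin 2) R) :
    Subgroup (GL (Fin 2) R) where
  carrier := {g | (g : Matrix (Fin 2) (Fin 2) R) * X = X * (g : Matrix (Fin 2) (Fin 2) R)}
  one_mem' := by simp
  mul_mem' := by
    intro g h hg hh
    exact Commute.mul_left (S := Matrix (Fin 2) (Fin 2) R) hg hh
  inv_mem' := by
    intro g hg
    exact Commute.units_inv_left (M := Matrix (Fin 2) (Fin 2) R) hg

section

variable {𝔬 : Type*} [CommRing 𝔬] [IsLocalRing 𝔬] {r : ℕ}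

/-- The congruence subgroup `M^i`, the kernel of `GL₂(𝔬_r) → GL₂(𝔬_i)`. -/
def congGL {i : ℕ} (h : i ≤ r) : Subgroup (GL (Fin 2) (Trunc 𝔬 r)) :=
  (Matrix.GeneralLinearGroup.map (red h)).ker

/-- The congruence subgroup `K^i`, the kernel of `SL₂(𝔬_r) → SL₂(𝔬_i)`. -/
def congSL {i : ℕ} (h : i ≤ r) : Subgroup (Matrix.SpecialLinearGroup (Fin 2) (Trunc 𝔬 r)) :=
  (Matrix.SpecialLinearGroup.map (red h)).ker

theorem congSL_entry {i : ℕ} (h : i ≤ r) {g : Matrix.SpecialLinearGroup (Fin 2) (Trunc 𝔬 r)}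
    (hg : g ∈ congSL h) (j k : Fin 2) :
    ((g : Matrix (Fin 2) (Fin 2) (Trunc 𝔬 r)) - 1) j k ∈ RingHom.ker (red (𝔬 := 𝔬) h) := by
  have h1 : Matrix.SpecialLinearGroup.map (red h) g = 1 := hg
  have h2 := congrArg (fun x : Matrix.SpecialLinearGroup (Fin 2) (Trunc 𝔬 i) => x j k) h1
  simp only [Matrix.SpecialLinearGroup.map_apply_coe, Matrix.SpecialLinearGroup.coe_one,
    RingHom.mapMatrix_apply, Matrix.map_apply] at h2
  rw [RingHom.mem_ker, Matrix.sub_apply, map_sub, h2, Matrix.one_apply, Matrix.one_apply]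
  split_ifs <;> simp

theorem mul_eq_zero_of_mem_ker {i : ℕ} (h : i ≤ r) (hi : r ≤ i + i) {x y : Trunc 𝔬 r}
    (hx : x ∈ RingHom.ker (red (𝔬 := 𝔬) h)) (hy : y ∈ RingHom.ker (red (𝔬 := 𝔬) h)) :
    x * y = 0 := by
  obtain ⟨x, rfl⟩ := Ideal.Quotient.mk_surjective x
  obtain ⟨y, rfl⟩ := Ideal.Quotient.mk_surjective y
  rw [RingHom.mem_ker, Ideal.Quotient.factor_mk, Ideal.Quotient.eq_zero_iff_mem] at hx hy
  rw [← map_mul, Ideal.Quotient.eq_zero_iff_mem]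
  refine Ideal.pow_le_pow_right hi ?_
  rw [pow_add]
  exact Ideal.mul_mem_mul hx hy

/-- The character `ψ_[A]` of `K^ℓ`. If `g = 1 + π ^ ℓ B` then
`trace (At * (g - 1)) = π ^ ℓ * trace (At * B)`, so that this is
`1 + π ^ ℓ B ↦ ψ (π ^ ℓ trace (At B))`; see `psiBr_apply`. -/
def psiBr (ψ : AddChar (Trunc 𝔬 r) ℂ) (At : Matrix (Fin 2) (Fin 2) (Trunc 𝔬 r)) :
    congSL (𝔬 := 𝔬) (ell_le r) →* ℂˣ :=
  MonoidHom.toHomUnits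
    { toFun := fun g =>
        ψ (Matrix.trace (At * (((g : Matrix.SpecialLinearGroup (Fin 2) (Trunc 𝔬 r)) :
          Matrix (Fin 2) (Fin 2) (Trunc 𝔬 r)) - 1)))
      map_one' := by simp
      map_mul' := by
        rintro ⟨g, hg⟩ ⟨h, hh⟩
        have key : ((g : Matrix (Fin 2) (Fin 2) (Trunc 𝔬 r)) - 1) *
            ((h : Matrix (Fin 2) (Fin 2) (Trunc 𝔬 r)) - 1) = 0 := by
          ext j k
          rw [Matrix.mul_apply]
          refine Finset.sum_eq_zero fun m _ => ?_
          exact mul_eq_zero_of_mem_ker (ell_le r) (le_two_mul_ell r)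
            (congSL_entry _ hg j m) (congSL_entry _ hh m k)
        have e : ((g * h : Matrix.SpecialLinearGroup (Fin 2) (Trunc 𝔬 r)) :
            Matrix (Fin 2) (Fin 2) (Trunc 𝔬 r)) - 1 =
            ((g : Matrix (Fin 2) (Fin 2) (Trunc 𝔬 r)) - 1) +
            ((h : Matrix (Fin 2) (Fin 2) (Trunc 𝔬 r)) - 1) := by
          rw [Matrix.SpecialLinearGroup.coe_mul, ← sub_eq_zero, ← key]
          noncomm_ring
        simp only [Subgroup.coe_mul]
        rw [← AddChar.map_add_eq_mul, ← Matrix.trace_add, ← Matrix.mul_add, e] }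

theorem psiBr_apply (ψ : AddChar (Trunc 𝔬 r) ℂ) (At B : Matrix (Fin 2) (Fin 2) (Trunc 𝔬 r))
    (p : 𝔬) (g : congSL (𝔬 := 𝔬) (ell_le r))
    (hg : ((g : Matrix.SpecialLinearGroup (Fin 2) (Trunc 𝔬 r)) :
      Matrix (Fin 2) (Fin 2) (Trunc 𝔬 r)) = 1 + toTrunc r (p ^ ell r) • B) :
    (psiBr ψ At g : ℂ) = ψ (toTrunc r (p ^ ell r) * Matrix.trace (At * B)) := by
  change ψ _ = _
  rw [hg, add_sub_cancel_left, Matrix.mul_smul, Matrix.trace_smul, smul_eq_mul]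

/-- `D_G^ℓ = (C_{GL₂(𝔬_r)}(At) ∩ M¹) M^ℓ` (a product with a normal subgroup). -/
def DG (hr : 1 ≤ r) (At : Matrix (Fin 2) (Fin 2) (Trunc 𝔬 r)) :
    Subgroup (GL (Fin 2) (Trunc 𝔬 r)) :=
  (centralizerGL At ⊓ congGL hr) ⊔ congGL (ell_le r)

/-- `D_S^ℓ = D_G^ℓ ∩ SL₂(𝔬_r)`. -/
def DS (hr : 1 ≤ r) (At : Matrix (Fin 2) (Fin 2) (Trunc 𝔬 r)) :
    Subgroup (Matrix.SpecialLinearGroup (Fin 2) (Trunc 𝔬 r)) :=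
  (DG hr At).comap Matrix.SpecialLinearGroup.toGL

end

/-- The one-dimensional representation `φ` of the subgroup `N` extends to the subgroup `H ⊇ N`. -/
def ExtendsTo {G : Type*} [Group G] {N : Subgroup G} (φ : N →* ℂˣ) (H : Subgroup G) : Prop :=
  ∃ h : N ≤ H, ∃ χ : H →* ℂˣ, χ.comp (Subgroup.inclusion h) = φ

/-- The unipotent matrix `e_x` with rows `(1, a⁻¹ x)` and `(0, 1)`. -/
def eMat {R : Type*} [CommRing R] (a : Rˣ) (x : R) : Matrix.SpecialLinearGroup (Fin 2) R :=
  ⟨!![1, ((a⁻¹ : Rˣ) : R) * x; 0, 1], by simp [Matrix.det_fin_two]⟩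

section

variable {𝔬 : Type*} [CommRing 𝔬] [IsLocalRing 𝔬] {r : ℕ}

/-- `h^i = {x ∈ 𝔬_r ∣ 2x ≡ 0 and x(x + β) ≡ 0 mod π ^ i}`. -/
def hSet (p : 𝔬) (i : ℕ) (β : Trunc 𝔬 r) : Set (Trunc 𝔬 r) :=
  {x | 2 * x ∈ Ideal.span {toTrunc r p ^ i} ∧ x * (x + β) ∈ Ideal.span {toTrunc r p ^ i}}

/-- `H^i = {e_x ∣ x ∈ h^i}`. -/
def HSet (p : 𝔬) (i : ℕ) (a : (Trunc 𝔬 r)ˣ) (β : Trunc 𝔬 r) :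
    Set (Matrix.SpecialLinearGroup (Fin 2) (Trunc 𝔬 r)) :=
  eMat a '' hSet p i β

/-- The set of those `e ∈ H^{ℓ'}` such that `ψ_[A]` extends to `D_S^ℓ ⟨e⟩`. -/
def EE' (p : 𝔬) (hr : 1 ≤ r) (ψ : AddChar (Trunc 𝔬 r) ℂ) (a : (Trunc 𝔬 r)ˣ)
    (α β : Trunc 𝔬 r) : Set (Matrix.SpecialLinearGroup (Fin 2) (Trunc 𝔬 r)) :=
  {e | e ∈ HSet p (ell' r) a β ∧
    ExtendsTo (psiBr ψ (cyc a α β)) (DS hr (cyc a α β) ⊔ Subgroup.zpowers e)}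

/-- The set `E'` of those `x ∈ h^{ℓ'}` for which `e_x ∈ EE'`. -/
def E' (p : 𝔬) (hr : 1 ≤ r) (ψ : AddChar (Trunc 𝔬 r) ℂ) (a : (Trunc 𝔬 r)ˣ)
    (α β : Trunc 𝔬 r) : Set (Trunc 𝔬 r) :=
  {x | x ∈ hSet p (ell' r) β ∧ eMat a x ∈ EE' p hr ψ a α β}

end

end SL2Trunc

end

/-!
Write `A = cyc a' α' β'`, `e_x = eMat a' x`, `D = DS hr A` and `H_x = D ⟨e_x⟩`. A linear character of
a subgroup `N` of a finite group `H` extends to `H` as soon as it is trivial on `N ∩ [H, H]`, because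
linear characters of subgroups of the finite abelian group `H / [H, H]` extend
(`extendsTo_of_commutator_le`); the condition is clearly necessary.

*Every `x` divisible by `p ^ ℓ'` lies in `E'`.* In `GL₂(𝔬_r)` the group `H_x` is contained in the
group generated by `C(A) ∩ M¹`, `M^ℓ` and `e_x`. The commutators of these generators lie in the kernel
`traceKer` of the character `1 + p ^ ℓ B ↦ ψ (p ^ ℓ trace (A B))` of `M^ℓ`: commutators with `M^ℓ` do
because the generators commute with `A` modulo `p ^ ℓ'`, so that they fix the character
(`commutator_mem_traceKer_of_congruent`), and the commutator of `e_x` and `u + y A` does because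
`p ∣ y` puts it in `M^ℓ`, while cyclicity of the trace makes the character trivial on it
(`commutator_mem_traceKer_of_centralizer`). As `traceKer` is normalised by the generators, it contains
`[H_x, H_x]`.

*Conversely*, if `β` is a unit and `r ≥ 2 (e + 1)`, then `2 x ≡ 0` forces `p ∣ x`, so `x + β` is a
unit and `x (x + β) ≡ 0` already gives `x ≡ 0` modulo `p ^ ℓ'`
(`pow_dvd_of_dvd_mul_add_unit`). If `r > 4 e`, let `2 x ≡ 0` but `x ≢ 0` modulo `p ^ ℓ'`. For
`u = 1 + z` with `p ∣ z` and `p ^ ℓ ∣ u ^ 2 - 1` the matrix `diag (u, u⁻¹) = u · diag (1, u⁻²)` is in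
`D`, and its commutator with `e_x` is `e_{x (1 - u ^ 2)}`, on which `ψ_[A]` takes the value
`ψ (x (1 - u ^ 2))`. The bound on `r` leaves room to choose `z` with `x (u ^ 2 - 1) = p ^ (r - 1)`
(`exists_dvd_mul_mul_add_two_sub`), and `ψ (p ^ (r - 1)) ≠ 1` prevents an extension
(`not_extendsTo_psiBr`).
-/

open scoped commutatorElement

namespace SL2Trunc

/-! ### Extending characters, and commutators of generated groups -/

theorem extendsTo_of_commutator_le {G : Type*} [Group G] [Finite G] {N H : Subgroup G}
    (φ : N →* ℂˣ) (h : N ≤ H) (hφ : ∀ n : N, (n : G) ∈ ⁅H, H⁆ → φ n = 1) : ExtendsTo φ H := by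
  let f : N →* Abelianization H := Abelianization.of.comp (Subgroup.inclusion h)
  have hker : f.rangeRestrict.ker ≤ φ.ker := by
    intro n hn
    rw [MonoidHom.ker_rangeRestrict, MonoidHom.mem_ker, MonoidHom.comp_apply, ← MonoidHom.mem_ker,
      Abelianization.ker_of] at hn
    refine hφ n ?_
    rw [← Subgroup.map_subtype_commutator H]
    exact ⟨_, hn, rfl⟩
  let φ' : f.range →* ℂˣ :=
    f.rangeRestrict.liftOfSurjective f.rangeRestrict_surjective ⟨φ, hker⟩
  obtain ⟨χ, hχ⟩ := MonoidHom.domRestrict_surjective ℂ f.range φ'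
  refine ⟨h, χ.comp Abelianization.of, ?_⟩
  ext1 n
  have h1 : φ' (f.rangeRestrict n) = φ n :=
    MonoidHom.liftOfRightInverse_comp_apply _ _ _ ⟨φ, hker⟩ n
  rw [← h1, ← hχ]
  rfl

/-- If the generators `S` normalise `K` and commute modulo `K`, then so do all elements of the group
they generate. -/
theorem commutatorElement_mem_of_closure {G : Type*} [Group G] {K : Subgroup G} {S : Set G}
    (hK : ∀ s ∈ S, s ∈ Subgroup.normalizer (K : Set G))
    (hS : ∀ s ∈ S, ∀ t ∈ S, ⁅s, t⁆ ∈ K) {g h : G}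
    (hg : g ∈ Subgroup.closure S) (hh : h ∈ Subgroup.closure S) : ⁅g, h⁆ ∈ K := by
  have hle : Subgroup.closure S ≤ Subgroup.normalizer (K : Set G) := (Subgroup.closure_le _).2 hK
  have conj : ∀ x ∈ Subgroup.closure S, ∀ k ∈ K, x * k * x⁻¹ ∈ K := fun x hx k hk =>
    (Subgroup.mem_normalizer_iff.1 (hle hx) k).1 hk
  induction hg, hh using Subgroup.closure_induction₂ with
  | mem x y hx hy => exact hS x hx y hy
  | one_left x hx => simp
  | one_right x hx => simp
  | mul_left x y z hx hy hz h1 h2 =>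
    have e : ⁅x * y, z⁆ = x * ⁅y, z⁆ * x⁻¹ * ⁅x, z⁆ := by
      simp only [commutatorElement_def]; group
    rw [e]
    exact mul_mem (conj x hx _ h2) h1
  | mul_right x y z hx hy hz h1 h2 =>
    have e : ⁅z, x * y⁆ = ⁅z, x⁆ * (x * ⁅z, y⁆ * x⁻¹) := by
      simp only [commutatorElement_def]; group
    rw [e]
    exact mul_mem h1 (conj x hx _ h2)
  | inv_left x y hx hy h =>
    have e : ⁅x⁻¹, y⁆ = x⁻¹ * ⁅x, y⁆⁻¹ * x⁻¹⁻¹ := by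
      simp only [commutatorElement_def]; group
    rw [e]
    exact conj _ (inv_mem hx) _ (inv_mem h)
  | inv_right x y hx hy h =>
    have e : ⁅x, y⁻¹⁆ = y⁻¹ * ⁅x, y⁆⁻¹ * y⁻¹⁻¹ := by
      simp only [commutatorElement_def]; group
    rw [e]
    exact conj _ (inv_mem hy) _ (inv_mem h)

/-! ### Matrices over a commutative ring -/

section

variable {R : Type*} [CommRing R]

theorem GL_inv_eq_one_sub {P : R} (hP : P * P = 0) {g : GL (Fin 2) R}
    {B : Matrix (Fin 2) (Fin 2) R} (hg : (g : Matrix (Fin 2) (Fin 2) R) = 1 + P • B) :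
    ((g⁻¹ : GL (Fin 2) R) : Matrix (Fin 2) (Fin 2) R) = 1 - P • B := by
  refine Units.inv_eq_of_mul_eq_one_right ?_
  rw [hg, add_mul, one_mul, mul_sub, mul_one, smul_mul_smul_comm, hP, zero_smul]
  abel

/-- The kernel of the character `1 + P B ↦ ψ (P trace (A B))` of the group of invertible matrices
congruent to `1` modulo `P`, where `P ^ 2 = 0`. The matrix `B` is determined only up to the
annihilator of `P`, which does not affect `P trace (A B)`. -/
def traceKer (ψ : AddChar R ℂ) (A : Matrix (Fin 2) (Fin 2) R) {P : R} (hP : P * P = 0) :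
    Subgroup (GL (Fin 2) R) where
  carrier := {g | ∃ B : Matrix (Fin 2) (Fin 2) R, (g : Matrix (Fin 2) (Fin 2) R) = 1 + P • B ∧
    ψ (P * Matrix.trace (A * B)) = 1}
  one_mem' := ⟨0, by simp, by simp⟩
  mul_mem' := by
    rintro g h ⟨B, hB, h1⟩ ⟨C, hC, h2⟩
    refine ⟨B + C, ?_, ?_⟩
    · rw [Units.val_mul, hB, hC, add_mul, one_mul, mul_add, mul_one, smul_mul_smul_comm, hP,
        zero_smul, smul_add]
      abel
    · rw [Matrix.mul_add, Matrix.trace_add, mul_add, AddChar.map_add_eq_mul, h1, h2, one_mul]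
  inv_mem' := by
    rintro g ⟨B, hB, h1⟩
    refine ⟨-B, ?_, ?_⟩
    · rw [GL_inv_eq_one_sub hP hB, smul_neg, sub_eq_add_neg]
    · rw [Matrix.mul_neg, Matrix.trace_neg, mul_neg, AddChar.map_neg_eq_inv, h1, inv_one]

variable {ψ : AddChar R ℂ} {A : Matrix (Fin 2) (Fin 2) R} {P Q : R} {hP : P * P = 0}

/-- If `s` commutes with `A` modulo `Q` and `P Q = 0`, then conjugation by `s` fixes the character
`1 + P B ↦ ψ (P trace (A B))`. -/
theorem commutator_mem_traceKer_of_congruent (hPQ : P * Q = 0)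
    {s m : GL (Fin 2) R} {Y B : Matrix (Fin 2) (Fin 2) R}
    (hs : A * (s : Matrix (Fin 2) (Fin 2) R) = s * A + Q • Y)
    (hm : (m : Matrix (Fin 2) (Fin 2) R) = 1 + P • B) : ⁅s, m⁆ ∈ traceKer ψ A hP := by
  have hss :
      (s : Matrix (Fin 2) (Fin 2) R) * ((s⁻¹ : GL (Fin 2) R) : Matrix (Fin 2) (Fin 2) R) = 1 :=
    Units.mul_inv s
  have hss' :
      ((s⁻¹ : GL (Fin 2) R) : Matrix (Fin 2) (Fin 2) R) * (s : Matrix (Fin 2) (Fin 2) R) = 1 :=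
    Units.inv_mul s
  have hmi := GL_inv_eq_one_sub hP hm
  refine ⟨(s : Matrix (Fin 2) (Fin 2) R) * B *
    ((s⁻¹ : GL (Fin 2) R) : Matrix (Fin 2) (Fin 2) R) - B, ?_, ?_⟩
  · rw [commutatorElement_def, Units.val_mul, Units.val_mul, Units.val_mul, hmi, hm, mul_add,
      mul_one, add_mul, hss, Matrix.mul_smul, Matrix.smul_mul, mul_sub, mul_one, add_mul, one_mul,
      smul_mul_smul_comm, hP, zero_smul, smul_sub]
    abel
  · have e : P * Matrix.trace (A *
        ((s : Matrix (Fin 2) (Fin 2) R) * B * ((s⁻¹ : GL (Fin 2) R) : Matrix (Fin 2) (Fin 2) R) - B)) = 0 := by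
      rw [mul_sub, ← mul_assoc, ← mul_assoc, hs, Matrix.trace_sub, Matrix.trace_mul_comm, ← mul_assoc,
        mul_add, ← mul_assoc, hss', one_mul, add_mul, Matrix.trace_add, add_sub_cancel_left,
        Matrix.mul_smul, Matrix.smul_mul, Matrix.trace_smul, smul_eq_mul, ← mul_assoc, hPQ, zero_mul]
    rw [e, AddChar.map_zero_eq_one]

/-- The commutator of `s = 1 + Q N` and `c = x + y A` is `1 + y Q (N A - A N) c⁻¹`, because `y Q` is a
multiple of `P` and `P Q = 0`. Since `c⁻¹` commutes with `A`, the trace of `A (N A - A N) c⁻¹`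
vanishes. -/
theorem commutator_mem_traceKer_of_centralizer (hPQ : P * Q = 0)
    {s c : GL (Fin 2) R} {N : Matrix (Fin 2) (Fin 2) R} {x y v : R}
    (hs : (s : Matrix (Fin 2) (Fin 2) R) = 1 + Q • N)
    (hc : (c : Matrix (Fin 2) (Fin 2) R) = x • 1 + y • A) (hy : y * Q = P * v) :
    ⁅s, c⁆ ∈ traceKer ψ A hP := by
  have hss :
      (s : Matrix (Fin 2) (Fin 2) R) * ((s⁻¹ : GL (Fin 2) R) : Matrix (Fin 2) (Fin 2) R) = 1 :=
    Units.mul_inv s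
  have hcc :
      (c : Matrix (Fin 2) (Fin 2) R) * ((c⁻¹ : GL (Fin 2) R) : Matrix (Fin 2) (Fin 2) R) = 1 :=
    Units.mul_inv c
  have hcc' :
      ((c⁻¹ : GL (Fin 2) R) : Matrix (Fin 2) (Fin 2) R) * (c : Matrix (Fin 2) (Fin 2) R) = 1 :=
    Units.inv_mul c
  set S := ((s⁻¹ : GL (Fin 2) R) : Matrix (Fin 2) (Fin 2) R) with hS
  set C := ((c⁻¹ : GL (Fin 2) R) : Matrix (Fin 2) (Fin 2) R) with hC
  have hAc : A * (c : Matrix (Fin 2) (Fin 2) R) = c * A := by rw [hc]; simp [mul_add, add_mul]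
  have hAC : C * A = A * C := by
    calc C * A = C * (A * (c * C)) := by rw [hcc, mul_one]
      _ = C * (A * c) * C := by simp only [mul_assoc]
      _ = A * C := by rw [hAc, ← mul_assoc, hcc', one_mul]
  have hS1 : S = 1 - Q • (N * S) := by
    rw [hs, add_mul, one_mul, Matrix.smul_mul] at hss
    exact eq_sub_of_add_eq hss
  -- Since `P Q = 0`, the factor `s⁻¹ = 1 - Q N s⁻¹` is invisible after multiplication by `P`.
  have hPS : P • S = P • (1 : Matrix (Fin 2) (Fin 2) R) := by
    conv_lhs => rw [hS1]
    rw [smul_sub, smul_smul, hPQ, zero_smul, sub_zero]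
  have hsc : (s : Matrix (Fin 2) (Fin 2) R) * c = c * s + P • v • (N * A - A * N) := by
    rw [smul_smul, ← hy, hs, hc]
    simp only [mul_add, add_mul, mul_one, one_mul, Matrix.smul_mul, Matrix.mul_smul, smul_sub,
      mul_smul, smul_comm Q y, smul_comm Q x]
    abel
  refine ⟨v • (N * A - A * N) * C, ?_, ?_⟩
  · have e : P • (v • (N * A - A * N) * C) = v • (N * A - A * N) * (P • S) * C := by
      rw [hPS, Matrix.mul_smul, mul_one, Matrix.smul_mul, Matrix.smul_mul, Matrix.smul_mul]
    have hcs : (c : Matrix (Fin 2) (Fin 2) R) * s * S * C = 1 := by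
      rw [mul_assoc (c : Matrix (Fin 2) (Fin 2) R), hss, mul_one, hcc]
    rw [e, commutatorElement_def, Units.val_mul, Units.val_mul, Units.val_mul, hsc, add_mul, add_mul,
      hcs, Matrix.smul_mul, Matrix.mul_smul]
  · have e : Matrix.trace (A * (v • (N * A - A * N) * C)) = 0 := by
      rw [Matrix.smul_mul, Matrix.mul_smul, Matrix.trace_smul, sub_mul, mul_sub, Matrix.trace_sub]
      have h1 : Matrix.trace (A * (N * A * C)) = Matrix.trace (A * (A * N * C)) := by
        rw [mul_assoc N, ← hAC, ← mul_assoc N, ← mul_assoc A, Matrix.trace_mul_comm]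
        simp only [mul_assoc]
      rw [h1, sub_self, smul_zero]
    rw [e, mul_zero, AddChar.map_zero_eq_one]

/-- As `A = cyc a α β` has the cyclic vector `(1, 0)`, its centralizer consists of polynomials in `A`. -/
theorem eq_smul_one_add_smul_cyc {a : Rˣ} {α β : R} {g : GL (Fin 2) R}
    (hg : g ∈ centralizerGL (cyc a α β)) :
    (g : Matrix (Fin 2) (Fin 2) R) =
      (g 0 0) • (1 : Matrix (Fin 2) (Fin 2) R) + (((a⁻¹ : Rˣ) : R) * g 1 0) • cyc a α β := by
  have h : (g : Matrix (Fin 2) (Fin 2) R) * cyc a α β = cyc a α β * g := hg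
  have h0 := congrFun (congrFun h 0) 0
  have h1 := congrFun (congrFun h 1) 0
  have ha : ((a⁻¹ : Rˣ) : R) * a = 1 := Units.inv_mul a
  simp [cyc, Matrix.mul_apply, Fin.sum_univ_two] at h0 h1
  ext i j
  fin_cases i <;> fin_cases j <;> simp [cyc]
  · linear_combination ((a⁻¹ : Rˣ) : R) * h0 - g 0 1 * ha
  · linear_combination -g 1 0 * ha
  · linear_combination ((a⁻¹ : Rˣ) : R) * h1 + (g 0 0 - g 1 1) * ha

theorem eMat_mul (a : Rˣ) (x y : R) : eMat a x * eMat a y = eMat a (x + y) := by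
  refine Subtype.ext ?_
  rw [Matrix.SpecialLinearGroup.coe_mul]
  simp [eMat, mul_add, add_comm]

theorem eMat_inv (a : Rˣ) (x : R) : (eMat a x)⁻¹ = eMat a (-x) := by
  rw [inv_eq_iff_mul_eq_one, eMat_mul, add_neg_cancel]
  ext i j
  fin_cases i <;> fin_cases j <;> simp [eMat]

/-- The diagonal matrix with entries `u` and `u⁻¹`. -/
def diagSL (u : Rˣ) : Matrix.SpecialLinearGroup (Fin 2) R :=
  ⟨!![(u : R), 0; 0, ((u⁻¹ : Rˣ) : R)], by simp [Matrix.det_fin_two]⟩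

theorem commutator_eMat_diagSL (a u : Rˣ) (x : R) :
    ⁅eMat a x, diagSL u⁆ = eMat a (x - u ^ 2 * x) := by
  have h : diagSL u * eMat a (-x) = eMat a (-(u ^ 2 * x)) * diagSL u := by
    have hu : (u : R) * ((u⁻¹ : Rˣ) : R) = 1 := Units.mul_inv u
    refine Subtype.ext ?_
    rw [Matrix.SpecialLinearGroup.coe_mul, Matrix.SpecialLinearGroup.coe_mul]
    simp [eMat, diagSL]
    linear_combination -((a⁻¹ : Rˣ) : R) * x * u * hu
  rw [commutatorElement_def, eMat_inv, mul_assoc (eMat a x), h, mul_assoc, mul_assoc, mul_inv_cancel,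
    mul_one, eMat_mul, sub_eq_add_neg]

end

/-! ### Congruence subgroups over a discrete valuation ring -/

section

variable {𝔬 : Type*} [CommRing 𝔬] [IsDomain 𝔬] [IsDiscreteValuationRing 𝔬] {p : 𝔬} {r : ℕ}

theorem toTrunc_eq_zero_iff (hp : Irreducible p) (x : 𝔬) : toTrunc r x = 0 ↔ p ^ r ∣ x := by
  rw [Ideal.Quotient.eq_zero_iff_mem, hp.maximalIdeal_eq, Ideal.span_singleton_pow,
    Ideal.mem_span_singleton]

theorem toTrunc_mem_span_iff (hp : Irreducible p) {i : ℕ} (h : i ≤ r) (x : 𝔬) :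
    toTrunc r x ∈ Ideal.span {toTrunc r p ^ i} ↔ p ^ i ∣ x := by
  rw [Ideal.mem_span_singleton]
  constructor
  · rintro ⟨y, hy⟩
    obtain ⟨y, rfl⟩ := Ideal.Quotient.mk_surjective y
    rw [← map_pow, ← map_mul, ← sub_eq_zero, ← map_sub, toTrunc_eq_zero_iff hp] at hy
    exact (dvd_sub_left (dvd_mul_right _ _)).1 ((pow_dvd_pow p h).trans hy)
  · rintro ⟨y, rfl⟩
    exact ⟨toTrunc r y, by simp⟩

theorem mem_ker_red_iff (hp : Irreducible p) {i : ℕ} (h : i ≤ r) (x : Trunc 𝔬 r) :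
    x ∈ RingHom.ker (red (𝔬 := 𝔬) h) ↔ toTrunc r p ^ i ∣ x := by
  obtain ⟨x, rfl⟩ := Ideal.Quotient.mk_surjective x
  rw [RingHom.mem_ker, Ideal.Quotient.factor_mk, toTrunc_eq_zero_iff hp,
    ← toTrunc_mem_span_iff hp h, Ideal.mem_span_singleton]

theorem toTrunc_pow_mul_pow (hp : Irreducible p) {i j : ℕ} (h : r ≤ i + j) :
    toTrunc r p ^ i * toTrunc r p ^ j = 0 := by
  rw [← pow_add, ← map_pow, toTrunc_eq_zero_iff hp]
  exact pow_dvd_pow p h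

theorem mem_congGL_iff (hp : Irreducible p) {i : ℕ} (h : i ≤ r) (g : GL (Fin 2) (Trunc 𝔬 r)) :
    g ∈ congGL (𝔬 := 𝔬) h ↔ ∃ B : Matrix (Fin 2) (Fin 2) (Trunc 𝔬 r),
      (g : Matrix (Fin 2) (Fin 2) (Trunc 𝔬 r)) = 1 + toTrunc r p ^ i • B := by
  have key : g ∈ congGL (𝔬 := 𝔬) h ↔ ∀ j k : Fin 2, toTrunc r p ^ i ∣
      ((g : Matrix (Fin 2) (Fin 2) (Trunc 𝔬 r)) - 1) j k := by
    simp only [← mem_ker_red_iff hp h]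
    rw [congGL, MonoidHom.mem_ker, Units.ext_iff, ← Matrix.ext_iff]
    refine forall₂_congr fun j k => ?_
    rw [RingHom.mem_ker, Matrix.sub_apply, map_sub, sub_eq_zero]
    simp only [Matrix.GeneralLinearGroup.map_apply, Units.val_one, Matrix.one_apply]
    split_ifs <;> simp
  rw [key]
  constructor
  · intro H
    choose B hB using H
    refine ⟨Matrix.of B, ?_⟩
    rw [← sub_eq_iff_eq_add']
    ext j k
    rw [hB, Matrix.smul_apply, smul_eq_mul, Matrix.of_apply]
  · rintro ⟨B, hB⟩ j k
    rw [hB, add_sub_cancel_left, Matrix.smul_apply]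
    exact dvd_mul_right _ _

theorem toGL_mem_congGL {i : ℕ} {h : i ≤ r} {g : Matrix.SpecialLinearGroup (Fin 2) (Trunc 𝔬 r)}
    (hg : g ∈ congSL (𝔬 := 𝔬) h) : Matrix.SpecialLinearGroup.toGL g ∈ congGL (𝔬 := 𝔬) h := by
  have h1 : Matrix.SpecialLinearGroup.map (red h) g = 1 := hg
  refine Units.ext ?_
  exact congrArg Subtype.val h1

theorem congSL_le_DS (hr : 1 ≤ r) (A : Matrix (Fin 2) (Fin 2) (Trunc 𝔬 r)) :
    congSL (𝔬 := 𝔬) (ell_le r) ≤ DS hr A := fun _ hg =>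
  Subgroup.mem_sup_right (S := centralizerGL A ⊓ congGL hr) (toGL_mem_congGL hg)

/-! ### Extension of the character for `x` divisible by `p ^ ℓ'` -/

/-- For `x` divisible by `p ^ ℓ'`, the derived subgroup of `D_S^ℓ ⟨e_x⟩` lies in the kernel of
`ψ_[A]`. -/
theorem commutator_le_comap_traceKer [Finite (ResidueField 𝔬)] (hp : Irreducible p) (hr : 1 ≤ r)
    (ψ : AddChar (Trunc 𝔬 r) ℂ) (a : (Trunc 𝔬 r)ˣ) (α β : Trunc 𝔬 r) {x : Trunc 𝔬 r}
    (hx : x ∈ Ideal.span {toTrunc r p ^ ell' r}) :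
    ⁅DS hr (cyc a α β) ⊔ Subgroup.zpowers (eMat a x),
      DS hr (cyc a α β) ⊔ Subgroup.zpowers (eMat a x)⁆ ≤
    (traceKer ψ (cyc a α β) (toTrunc_pow_mul_pow hp (le_two_mul_ell r))).comap
      Matrix.SpecialLinearGroup.toGL := by
  have : Finite (Trunc 𝔬 r) := by
    have : Finite (𝔬 ⧸ maximalIdeal 𝔬) := ‹Finite (ResidueField 𝔬)›
    exact Ideal.finite_quotient_pow (IsNoetherian.noetherian _) _
  obtain ⟨μ, rfl⟩ := Ideal.mem_span_singleton.1 hx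
  set A := cyc a α β with hA
  set q := toTrunc r p with hq
  set P := q ^ ell r with hP
  set Q := q ^ ell' r with hQ
  set ε := Matrix.SpecialLinearGroup.toGL (eMat a (Q * μ)) with hε
  have hPQ : P * Q = 0 := toTrunc_pow_mul_pow hp (by unfold ell ell'; omega)
  have hεN : (ε : Matrix (Fin 2) (Fin 2) (Trunc 𝔬 r)) =
      1 + Q • !![0, ((a⁻¹ : (Trunc 𝔬 r)ˣ) : Trunc 𝔬 r) * μ; 0, 0] := by
    change !![1, ((a⁻¹ : (Trunc 𝔬 r)ˣ) : Trunc 𝔬 r) * (Q * μ); 0, 1] = _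
    rw [mul_left_comm]
    ext i j
    fin_cases i <;> fin_cases j <;> simp
  -- The factor `p` dividing `y` makes up for the gap `ℓ ≤ ℓ' + 1`.
  obtain ⟨v, hv⟩ : ∃ v, q * Q = P * v :=
    ⟨q ^ (ell' r + 1 - ell r), by
      rw [hP, hQ, ← pow_succ', ← pow_add]; congr 1; unfold ell ell'; omega⟩
  obtain ⟨w, hw⟩ : ∃ w, P = Q * w := pow_dvd_pow q (by unfold ell ell'; omega)
  let S : Set (GL (Fin 2) (Trunc 𝔬 r)) :=
    {g | g ∈ centralizerGL A ⊓ congGL hr} ∪ {g | g ∈ congGL (𝔬 := 𝔬) (ell_le r)} ∪ {ε}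
  have stab : ∀ s ∈ S, ∃ Y, A * (s : Matrix (Fin 2) (Fin 2) (Trunc 𝔬 r)) = s * A + Q • Y := by
    have one_add : ∀ N : Matrix (Fin 2) (Fin 2) (Trunc 𝔬 r),
        A * (1 + Q • N) = (1 + Q • N) * A + Q • (A * N - N * A) := by
      intro N
      rw [mul_add, add_mul, mul_one, one_mul, Matrix.mul_smul, Matrix.smul_mul, smul_sub]
      abel
    rintro s ((hs | hs) | hs)
    · exact ⟨0, by rw [smul_zero, add_zero]; exact hs.1.symm⟩
    · obtain ⟨B, hB⟩ := (mem_congGL_iff hp (ell_le r) s).1 hs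
      have hB' : (s : Matrix (Fin 2) (Fin 2) (Trunc 𝔬 r)) = 1 + Q • w • B := by
        rw [hB, smul_smul, ← hw]
      exact ⟨_, by rw [hB']; exact one_add _⟩
    · rw [Set.mem_singleton_iff.1 hs, hεN]
      exact ⟨_, one_add _⟩
  -- Applied to `m` in the kernel itself, this also shows that the generators normalise the kernel.
  have hcong : ∀ s ∈ S, ∀ m ∈ congGL (𝔬 := 𝔬) (ell_le r),
      ⁅s, m⁆ ∈ traceKer ψ A (toTrunc_pow_mul_pow hp (le_two_mul_ell r)) := by
    intro s hs m hm
    obtain ⟨Y, hY⟩ := stab s hs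
    obtain ⟨B, hB⟩ := (mem_congGL_iff hp (ell_le r) m).1 hm
    exact commutator_mem_traceKer_of_congruent hPQ hY hB
  have hcent : ∀ c ∈ centralizerGL A ⊓ congGL hr,
      ⁅ε, c⁆ ∈ traceKer ψ A (toTrunc_pow_mul_pow hp (le_two_mul_ell r)) := by
    rintro c ⟨hc1, hc2⟩
    obtain ⟨B, hB⟩ := (mem_congGL_iff hp hr c).1 hc2
    have h10 : c 1 0 = q * B 1 0 := by simp [hB, hq]
    refine commutator_mem_traceKer_of_centralizer (v := ((a⁻¹ : (Trunc 𝔬 r)ˣ) : Trunc 𝔬 r) *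
      B 1 0 * v) hPQ hεN (eq_smul_one_add_smul_cyc hc1) ?_
    rw [h10]
    linear_combination ((a⁻¹ : (Trunc 𝔬 r)ˣ) : Trunc 𝔬 r) * B 1 0 * hv
  have hmap : ∀ g ∈ DS hr A ⊔ Subgroup.zpowers (eMat a (Q * μ)),
      Matrix.SpecialLinearGroup.toGL g ∈ Subgroup.closure S := by
    have hle : DS hr A ⊔ Subgroup.zpowers (eMat a (Q * μ)) ≤
        (Subgroup.closure S).comap Matrix.SpecialLinearGroup.toGL := by
      refine sup_le (Subgroup.comap_mono (sup_le ?_ ?_)) ?_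
      · exact fun g hg => Subgroup.subset_closure (Or.inl (Or.inl hg))
      · exact fun g hg => Subgroup.subset_closure (Or.inl (Or.inr hg))
      · rw [Subgroup.zpowers_le]
        exact Subgroup.subset_closure (Or.inr rfl)
    exact hle
  rw [Subgroup.commutator_le]
  intro g hg h hh
  rw [Subgroup.mem_comap, map_commutatorElement]
  refine commutatorElement_mem_of_closure (fun s hs => ?_) (fun s hs t ht => ?_) (hmap g hg)
    (hmap h hh)
  · refine Subgroup.mem_normalizer_fintype fun k hk => ?_
    have hk' : k ∈ congGL (𝔬 := 𝔬) (ell_le r) := by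
      obtain ⟨B, hB, -⟩ := hk
      exact (mem_congGL_iff hp (ell_le r) k).2 ⟨B, hB⟩
    have e : s * k * s⁻¹ = ⁅s, k⁆ * k := by rw [commutatorElement_def]; group
    rw [e]
    exact mul_mem (hcong s hs k hk') hk
  · rcases ht with (ht | ht) | ht
    · rcases hs with (hs | hs) | hs
      · have : ⁅s, t⁆ = 1 := by
          rw [commutatorElement_eq_one_iff_mul_comm]
          refine Units.ext ?_
          rw [Units.val_mul, Units.val_mul, eq_smul_one_add_smul_cyc hs.1,
            eq_smul_one_add_smul_cyc ht.1]
          simp only [mul_add, add_mul, Matrix.smul_mul, Matrix.mul_smul, mul_one, one_mul, smul_smul,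
            mul_comm]
          abel
        rw [this]
        exact one_mem _
      · rw [← commutatorElement_inv]
        exact inv_mem (hcong t (Or.inl (Or.inl ht)) s hs)
      · rw [Set.mem_singleton_iff.1 hs]
        exact hcent t ht
    · exact hcong s hs t ht
    · rw [Set.mem_singleton_iff.1 ht, ← commutatorElement_inv]
      rcases hs with (hs | hs) | hs
      · exact inv_mem (hcent s hs)
      · exact inv_mem (hcong ε (Or.inr rfl) s hs)
      · rw [Set.mem_singleton_iff.1 hs, commutatorElement_self, inv_one]
        exact one_mem _

theorem extendsTo_psiBr [Finite (ResidueField 𝔬)] (hp : Irreducible p) (hr : 1 ≤ r)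
    (ψ : AddChar (Trunc 𝔬 r) ℂ) (a : (Trunc 𝔬 r)ˣ) (α β : Trunc 𝔬 r) {x : Trunc 𝔬 r}
    (hx : x ∈ Ideal.span {toTrunc r p ^ ell' r}) :
    ExtendsTo (psiBr ψ (cyc a α β)) (DS hr (cyc a α β) ⊔ Subgroup.zpowers (eMat a x)) := by
  have : Finite (Trunc 𝔬 r) := by
    have : Finite (𝔬 ⧸ maximalIdeal 𝔬) := ‹Finite (ResidueField 𝔬)›
    exact Ideal.finite_quotient_pow (IsNoetherian.noetherian _) _
  refine extendsTo_of_commutator_le _ ((congSL_le_DS hr _).trans le_sup_left) fun n hn => ?_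
  obtain ⟨B, hB, h1⟩ := commutator_le_comap_traceKer hp hr ψ a α β hx hn
  refine Units.ext ?_
  rw [← map_pow] at hB h1
  rw [psiBr_apply ψ _ B p n hB, h1, Units.val_one]

/-! ### Obstruction to the extension -/

theorem psiBr_eMat (ψ : AddChar (Trunc 𝔬 r) ℂ) (a : (Trunc 𝔬 r)ˣ) (α β x : Trunc 𝔬 r)
    (g : congSL (𝔬 := 𝔬) (ell_le r))
    (hg : (g : Matrix.SpecialLinearGroup (Fin 2) (Trunc 𝔬 r)) = eMat a x) :
    (psiBr ψ (cyc a α β) g : ℂ) = ψ x := by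
  change ψ _ = _
  rw [hg]
  congr 1
  have h : ((eMat a x : Matrix.SpecialLinearGroup (Fin 2) (Trunc 𝔬 r)) :
      Matrix (Fin 2) (Fin 2) (Trunc 𝔬 r)) - 1 =
        !![0, ((a⁻¹ : (Trunc 𝔬 r)ˣ) : Trunc 𝔬 r) * x; 0, 0] := by
    change !![1, ((a⁻¹ : (Trunc 𝔬 r)ˣ) : Trunc 𝔬 r) * x; 0, 1] - 1 = _
    ext i j
    fin_cases i <;> fin_cases j <;> simp
  rw [h]
  simp [cyc, Matrix.trace_fin_two]

/-- The matrix `diag (u, u⁻¹)` is the product of the scalar `u ∈ M¹` and of `diag (1, u⁻²) ∈ M^ℓ`,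
neither of which need have determinant `1`. -/
theorem diagSL_mem_DS (hp : Irreducible p) (hr : 1 ≤ r) (A : Matrix (Fin 2) (Fin 2) (Trunc 𝔬 r))
    (u : (Trunc 𝔬 r)ˣ) (h1 : toTrunc r p ∣ u - 1)
    (h2 : toTrunc r p ^ ell r ∣ (u : Trunc 𝔬 r) ^ 2 - 1) :
    diagSL u ∈ DS hr A := by
  let c : GL (Fin 2) (Trunc 𝔬 r) := Units.map (Matrix.scalar (Fin 2)).toMonoidHom u
  have hc : (c : Matrix (Fin 2) (Fin 2) (Trunc 𝔬 r)) = (u : Trunc 𝔬 r) • 1 := by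
    simp [c, Matrix.smul_one_eq_diagonal]
  have hcc : ((c⁻¹ : GL (Fin 2) (Trunc 𝔬 r)) : Matrix (Fin 2) (Fin 2) (Trunc 𝔬 r)) =
      ((u⁻¹ : (Trunc 𝔬 r)ˣ) : Trunc 𝔬 r) • 1 := by
    refine Units.inv_eq_of_mul_eq_one_right ?_
    rw [hc, smul_mul_smul_comm, Units.mul_inv, one_smul, one_mul]
  have hu : (u : Trunc 𝔬 r) * ((u⁻¹ : (Trunc 𝔬 r)ˣ) : Trunc 𝔬 r) = 1 := Units.mul_inv u
  obtain ⟨y, hy⟩ := h1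
  obtain ⟨z, hz⟩ := h2
  have e : Matrix.SpecialLinearGroup.toGL (diagSL u) =
      c * (c⁻¹ * Matrix.SpecialLinearGroup.toGL (diagSL u)) := by group
  change Matrix.SpecialLinearGroup.toGL (diagSL u) ∈ DG hr A
  rw [e]
  refine mul_mem (Subgroup.mem_sup_left ⟨?_, ?_⟩) (Subgroup.mem_sup_right ?_)
  · change (c : Matrix (Fin 2) (Fin 2) (Trunc 𝔬 r)) * A = A * c
    rw [hc]; simp
  · refine (mem_congGL_iff hp hr c).2 ⟨y • 1, ?_⟩
    rw [hc, pow_one, smul_smul, ← hy, sub_smul, one_smul]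
    abel
  · refine (mem_congGL_iff hp (ell_le r) _).2
      ⟨!![0, 0; 0, -(((u⁻¹ : (Trunc 𝔬 r)ˣ) : Trunc 𝔬 r) ^ 2 * z)], ?_⟩
    rw [Units.val_mul, hcc]
    change _ * !![(u : Trunc 𝔬 r), 0; 0, ((u⁻¹ : (Trunc 𝔬 r)ˣ) : Trunc 𝔬 r)] = _
    ext i j
    fin_cases i <;> fin_cases j <;> simp
    linear_combination -((u⁻¹ : (Trunc 𝔬 r)ˣ) : Trunc 𝔬 r) ^ 2 * hz +
      (u * ((u⁻¹ : (Trunc 𝔬 r)ˣ) : Trunc 𝔬 r) + 1) * hu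

/-- With `u = 1 + z`, the commutator of `e_x` and `diag (u, u⁻¹)` lies in `K^ℓ`, and `ψ_[A]` takes on
it the value `ψ (-x z (z + 2))`. -/
theorem not_extendsTo_psiBr (hp : Irreducible p) (hr : 1 ≤ r)
    {ψ : AddChar (Trunc 𝔬 r) ℂ} (a : (Trunc 𝔬 r)ˣ) (α β : Trunc 𝔬 r) {x z : Trunc 𝔬 r}
    (hz : toTrunc r p ∣ z) (hz2 : toTrunc r p ^ ell r ∣ z * (z + 2))
    (hxz : ψ (x * (z * (z + 2))) ≠ 1) :
    ¬ ExtendsTo (psiBr ψ (cyc a α β)) (DS hr (cyc a α β) ⊔ Subgroup.zpowers (eMat a x)) := by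
  rintro ⟨h, χ, hχ⟩
  have hnil : IsNilpotent z := by
    obtain ⟨y, rfl⟩ := hz
    exact ⟨r, by rw [mul_pow, ← map_pow, (toTrunc_eq_zero_iff hp _).2 dvd_rfl, zero_mul]⟩
  obtain ⟨u, hu⟩ := hnil.isUnit_one_add
  have hu2 : (u : Trunc 𝔬 r) ^ 2 - 1 = z * (z + 2) := by rw [hu]; ring
  have hcomm : ⁅eMat a x, diagSL u⁆ = eMat a (-(x * (z * (z + 2)))) := by
    rw [commutator_eMat_diagSL, ← hu2]; congr 1; ring
  have hmem : ⁅eMat a x, diagSL u⁆ ∈ congSL (𝔬 := 𝔬) (ell_le r) := by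
    have hker : -(x * (z * (z + 2))) ∈ RingHom.ker (red (𝔬 := 𝔬) (ell_le r)) :=
      (mem_ker_red_iff hp _ _).2 ((hz2.mul_left x).neg_right)
    rw [hcomm]
    refine Subtype.ext ?_
    change (!![1, ((a⁻¹ : (Trunc 𝔬 r)ˣ) : Trunc 𝔬 r) * -(x * (z * (z + 2))); 0, 1]).map
      (red (𝔬 := 𝔬) (ell_le r)) = 1
    ext i j
    rw [RingHom.mem_ker] at hker
    fin_cases i <;> fin_cases j <;> simp only [Matrix.map_apply]
    · simp
    · change red (𝔬 := 𝔬) (ell_le r) (((a⁻¹ : (Trunc 𝔬 r)ˣ) : Trunc 𝔬 r) *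
        -(x * (z * (z + 2)))) = 0
      rw [map_mul, hker, mul_zero]
    · simp
    · simp
  have he : eMat a x ∈ DS hr (cyc a α β) ⊔ Subgroup.zpowers (eMat a x) :=
    Subgroup.mem_sup_right (Subgroup.mem_zpowers _)
  have hd : diagSL u ∈ DS hr (cyc a α β) ⊔ Subgroup.zpowers (eMat a x) :=
    Subgroup.mem_sup_left (diagSL_mem_DS hp hr _ u (by rwa [hu, add_sub_cancel_left])
      (by rwa [hu2]))
  have h1 : χ (Subgroup.inclusion h ⟨_, hmem⟩) = 1 := by
    have e : Subgroup.inclusion h ⟨_, hmem⟩ = ⁅(⟨_, he⟩ : (DS hr (cyc a α β) ⊔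
        Subgroup.zpowers (eMat a x) : Subgroup _)), ⟨_, hd⟩⁆ := rfl
    rw [e, map_commutatorElement, commutatorElement_eq_one_iff_mul_comm, mul_comm]
  have h2 : psiBr ψ (cyc a α β) ⟨_, hmem⟩ = 1 := by rw [← hχ]; exact h1
  have h3 := psiBr_eMat ψ a α β _ ⟨_, hmem⟩ hcomm
  rw [h2, Units.val_one, AddChar.map_neg_eq_inv] at h3
  exact hxz (inv_eq_one.1 h3.symm)

/-! ### Valuations -/

/-- If `x` has valuation `j < ℓ'`, the required `z` has valuation `r - 1 - j - e`: then `2 x z` has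
valuation `r - 1`, while `x z ^ 2` vanishes modulo `p ^ r` because `2 e < ℓ`. -/
theorem exists_dvd_mul_mul_add_two_sub (hp : Irreducible p) {e : ℕ}
    (he : Ideal.span {(2 : 𝔬)} = Ideal.span {p ^ e})
    (hre : 4 * e < r) {x : 𝔬} (hx : p ^ ell' r ∣ 2 * x) (hx' : ¬ p ^ ell' r ∣ x) :
    ∃ z : 𝔬, p ∣ z ∧ p ^ ell r ∣ z * (z + 2) ∧ p ^ r ∣ x * (z * (z + 2)) - p ^ (r - 1) := by
  obtain ⟨u, hu⟩ := (Ideal.span_singleton_eq_span_singleton.1 he).symm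
  replace hu := hu.symm
  have hx0 : x ≠ 0 := fun h => hx' (h ▸ dvd_zero _)
  obtain ⟨j, v, rfl⟩ := IsDiscreteValuationRing.eq_unit_mul_pow_irreducible hx0 hp
  have hj : j < ell' r := by
    by_contra! h
    exact hx' ((pow_dvd_pow p h).mul_left _)
  have hje : ell' r ≤ e + j := by
    have h1 : 2 * ((v : 𝔬) * p ^ j) = p ^ (e + j) * ((u * v : 𝔬ˣ) : 𝔬) := by
      rw [hu, pow_add, Units.val_mul]; ring
    rw [h1, Units.dvd_mul_right] at hx
    exact (pow_dvd_pow_iff hp.ne_zero hp.not_isUnit).1 hx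
  have hl : ell r + ell' r = r := by unfold ell ell'; omega
  have hl' : 2 * e + 1 ≤ ell r := by unfold ell; omega
  have hll : ell' r ≤ ell r := by unfold ell ell'; omega
  -- `k` is the valuation of `z`; the unit `w` makes `2 x z` equal to `p ^ (r - 1)`.
  obtain ⟨k, hk⟩ : ∃ k, k + j + e + 1 = r := ⟨r - 1 - j - e, by omega⟩
  have hvu : (v : 𝔬) * u * ((v * u)⁻¹ : 𝔬ˣ) = 1 := by
    rw [← Units.val_mul, Units.mul_inv]
  set w : 𝔬 := (((v * u)⁻¹ : 𝔬ˣ) : 𝔬) with hw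
  refine ⟨p ^ k * w, ?_, ?_, ?_⟩
  · exact (dvd_pow_self p (by omega)).mul_right _
  · have h1 : p ^ k * w * (p ^ k * w + 2) = p ^ (k + k) * w ^ 2 + p ^ (k + e) * (w * u) := by
      rw [hu]; ring
    rw [h1]
    exact dvd_add ((pow_dvd_pow p (by omega)).mul_right _) ((pow_dvd_pow p (by omega)).mul_right _)
  · have h1 : r - 1 = j + k + e := by omega
    have h2 : v * p ^ j * (p ^ k * w * (p ^ k * w + 2)) - p ^ (r - 1) =
        p ^ (j + (k + k)) * (v * w ^ 2) := by
      rw [hu, h1]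
      linear_combination p ^ (j + k + e) * hvu
    rw [h2]
    exact (pow_dvd_pow p (by omega)).mul_right _

theorem pow_dvd_of_dvd_mul_add_unit (hp : Irreducible p) {e : ℕ}
    (he : Ideal.span {(2 : 𝔬)} = Ideal.span {p ^ e}) {i : ℕ} (hi : e + 1 ≤ i) {x b : 𝔬}
    (hb : IsUnit b) (hx : p ^ i ∣ 2 * x) (hxb : p ^ i ∣ x * (x + b)) : p ^ i ∣ x := by
  obtain ⟨u, hu⟩ := (Ideal.span_singleton_eq_span_singleton.1 he).symm
  have hpx : p ∣ x := by
    have h1 : p ^ e * p ∣ p ^ e * (u * x) := by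
      rw [← pow_succ, ← mul_assoc, hu]
      exact (pow_dvd_pow p hi).trans hx
    exact Units.dvd_mul_left.1 ((mul_dvd_mul_iff_left (pow_ne_zero e hp.ne_zero)).1 h1)
  have hunit : IsUnit (x + b) := by
    have h1 : ¬ p ∣ x + b := fun h => hp.not_isUnit
      (isUnit_of_dvd_unit ((dvd_add_right hpx).1 h) hb)
    by_contra h
    rw [← mem_nonunits_iff, ← mem_maximalIdeal, hp.maximalIdeal_eq,
      Ideal.mem_span_singleton] at h
    exact h1 h
  exact hunit.dvd_mul_right.1 hxb

/-- The inclusion `p ^ ℓ' 𝔬_r ⊆ E'` always holds, so that only the reverse one has to be checked. -/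
theorem E'_eq [Finite (ResidueField 𝔬)] (hp : Irreducible p) (hr : 1 ≤ r)
    (ψ : AddChar (Trunc 𝔬 r) ℂ) (a : (Trunc 𝔬 r)ˣ) (α β : Trunc 𝔬 r)
    (h : ∀ x ∈ hSet p (ell' r) β,
      ExtendsTo (psiBr ψ (cyc a α β)) (DS hr (cyc a α β) ⊔ Subgroup.zpowers (eMat a x)) →
        x ∈ Ideal.span {toTrunc r p ^ ell' r}) :
    E' p hr ψ a α β = (Ideal.span {toTrunc r p ^ ell' r} : Set (Trunc 𝔬 r)) := by
  ext x
  constructor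
  · exact fun hx => h x hx.1 hx.2.2
  · intro hx
    have hx' : x ∈ hSet p (ell' r) β :=
      ⟨Ideal.mul_mem_left _ _ hx, Ideal.mul_mem_right _ _ hx⟩
    exact ⟨hx', ⟨x, hx', rfl⟩, extendsTo_psiBr hp hr ψ a α β hx⟩

end
end SL2Trunc

theorem mainTheorem7
    {𝔬 : Type*} [CommRing 𝔬] [IsDomain 𝔬] [IsDiscreteValuationRing 𝔬]
    [TopologicalSpace 𝔬] [CompactSpace 𝔬] (hadic : IsAdic (IsLocalRing.maximalIdeal 𝔬))
    [Finite (IsLocalRing.ResidueField 𝔬)] [CharP (IsLocalRing.ResidueField 𝔬) 2] [CharZero 𝔬]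
    (p : 𝔬) (hp : Irreducible p)
    (e : ℕ) (he : Ideal.span {(2 : 𝔬)} = Ideal.span {p ^ e})
    (r : ℕ) (hr : 2 ≤ r)
    (ψ : AddChar (SL2Trunc.Trunc 𝔬 r) ℂ) (hψ : ψ (SL2Trunc.toTrunc r p ^ (r - 1)) ≠ 1)
    (a : (SL2Trunc.Trunc 𝔬 (SL2Trunc.ell' r))ˣ) (α β : SL2Trunc.Trunc 𝔬 (SL2Trunc.ell' r))
    (a' : (SL2Trunc.Trunc 𝔬 r)ˣ) (α' β' : SL2Trunc.Trunc 𝔬 r)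
    (hlift : (SL2Trunc.cyc a' α' β').map (SL2Trunc.red (SL2Trunc.ell'_le r)) =
      SL2Trunc.cyc a α β) :
    (2 * (e + 1) ≤ r → IsUnit β →
      SL2Trunc.E' p (one_le_two.trans hr) ψ a' α' β' =
        (Ideal.span {SL2Trunc.toTrunc r p ^ SL2Trunc.ell' r} : Set (SL2Trunc.Trunc 𝔬 r))) ∧
    (4 * e < r → β ∈ Ideal.span {SL2Trunc.toTrunc (SL2Trunc.ell' r) p} →
      SL2Trunc.E' p (one_le_two.trans hr) ψ a' α' β' =
        (Ideal.span {SL2Trunc.toTrunc r p ^ SL2Trunc.ell' r} : Set (SL2Trunc.Trunc 𝔬 r))) := by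
  refine ⟨fun hre hβ => SL2Trunc.E'_eq hp _ ψ a' α' β' ?_,
    fun hre _ => SL2Trunc.E'_eq hp _ ψ a' α' β' ?_⟩
  · rintro x ⟨hx2, hxβ⟩ -
    obtain ⟨x, rfl⟩ := Ideal.Quotient.mk_surjective x
    obtain ⟨b, rfl⟩ := Ideal.Quotient.mk_surjective β'
    have hb : IsUnit b := by
      have h1 : SL2Trunc.toTrunc (SL2Trunc.ell' r) b = β := congrFun (congrFun hlift 1) 1
      by_contra hb
      rw [← mem_nonunits_iff, ← mem_maximalIdeal, hp.maximalIdeal_eq,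
        Ideal.mem_span_singleton] at hb
      have hβ0 : β ^ SL2Trunc.ell' r = 0 := by
        rw [← h1, ← map_pow, SL2Trunc.toTrunc_eq_zero_iff hp]
        exact pow_dvd_pow_of_dvd hb _
      -- A unit is not nilpotent in `𝔬_{ℓ'}`, which is not the zero ring because `ℓ' ≥ 1`.
      have h2 : (0 : SL2Trunc.Trunc 𝔬 (SL2Trunc.ell' r)) = 1 :=
        isUnit_zero_iff.1 (hβ0 ▸ hβ.pow _)
      rw [eq_comm, ← map_one (SL2Trunc.toTrunc (SL2Trunc.ell' r)),
        SL2Trunc.toTrunc_eq_zero_iff hp] at h2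
      exact hp.not_isUnit (isUnit_of_dvd_one
        ((dvd_pow_self p (by unfold SL2Trunc.ell'; omega)).trans h2))
    have hle := SL2Trunc.ell'_le r
    rw [← map_ofNat (SL2Trunc.toTrunc r) 2, ← map_mul,
      SL2Trunc.toTrunc_mem_span_iff hp hle] at hx2
    rw [← map_add, ← map_mul, SL2Trunc.toTrunc_mem_span_iff hp hle] at hxβ
    rw [SL2Trunc.toTrunc_mem_span_iff hp hle]
    exact SL2Trunc.pow_dvd_of_dvd_mul_add_unit hp he (by unfold SL2Trunc.ell'; omega) hb hx2 hxβ
  · rintro x ⟨hx2, -⟩ hext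
    obtain ⟨x, rfl⟩ := Ideal.Quotient.mk_surjective x
    have hle := SL2Trunc.ell'_le r
    rw [← map_ofNat (SL2Trunc.toTrunc r) 2, ← map_mul,
      SL2Trunc.toTrunc_mem_span_iff hp hle] at hx2
    by_contra hx
    rw [SL2Trunc.toTrunc_mem_span_iff hp hle] at hx
    obtain ⟨z, hz, hz2, hxz⟩ := SL2Trunc.exists_dvd_mul_mul_add_two_sub hp he hre hx2 hx
    refine SL2Trunc.not_extendsTo_psiBr hp _ a' α' β' (z := SL2Trunc.toTrunc r z)
      (map_dvd _ hz) ?_ ?_ hext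
    · rw [← map_ofNat (SL2Trunc.toTrunc r) 2, ← map_add, ← map_mul, ← map_pow]
      exact map_dvd _ hz2
    · rw [← SL2Trunc.toTrunc_eq_zero_iff hp, map_sub, sub_eq_zero] at hxz
      rw [← map_ofNat (SL2Trunc.toTrunc r) 2, ← map_add, ← map_mul, ← map_mul, hxz, map_pow]
      exact hψ
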